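/- Theorem 2.1. Let $D\subset\mathbb{C}^n$ be a bounded domain (a nonempty, bounded, connected open set), let $\mathrm{Aut}(D)$ be the group of biholomorphic maps of $D$ onto itself, with the compact-open topology, and let $H$ be a compact subgroup of $\mathrm{Aut}(D)$. Assume that every $f\in H$ extends holomorphically beyond $\overline{D}$, i.e. for every $f\in H$ there are an open neighbourhood $U_f$ of $\overline{D}$ and a holomorphic map $\tilde f:U_f\to\mathbb{C}^n$ with $\tilde f|_D=f$. Then there is a single domain $U\subset\mathbb{C}^n$ (a nonempty connected open set) with $U\supset\overline{D}$ such that every $f\in H$ extends to an automorphism of $U$, i.e. for every $f\in H$ there is $F\in\mathrm{Aut}(U)$ with $F|_D=f$. -/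

import Mathlib

/-- A self-map `f : D → D` of an open set `D ⊆ ℂⁿ` is holomorphic. (`F` is an arbitrary function on
the ambient space; only its values on the open set `D` matter.) -/
def IsHolomorphicSelfMap {n : ℕ} (D : Set (EuclideanSpace ℂ (Fin n))) (f : D → D) : Prop :=
  ∃ F : EuclideanSpace ℂ (Fin n) → EuclideanSpace ℂ (Fin n),
    DifferentiableOn ℂ F D ∧ ∀ z : D, F z = f z

theorem IsHolomorphicSelfMap.id {n : ℕ} (D : Set (EuclideanSpace ℂ (Fin n))) :
    IsHolomorphicSelfMap D (fun z => z) :=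
  ⟨fun z => z, differentiableOn_id, fun _ => rfl⟩

theorem IsHolomorphicSelfMap.comp {n : ℕ} {D : Set (EuclideanSpace ℂ (Fin n))} {f g : D → D}
    (hf : IsHolomorphicSelfMap D f) (hg : IsHolomorphicSelfMap D g) :
    IsHolomorphicSelfMap D (f ∘ g) := by
  obtain ⟨F, hF, hFf⟩ := hf
  obtain ⟨G, hG, hGg⟩ := hg
  refine ⟨F ∘ G, hF.comp hG ?_, ?_⟩
  · intro z hz
    have h := hGg ⟨z, hz⟩
    simp only at h
    rw [h]
    exact (g ⟨z, hz⟩).2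
  · intro z
    simp only [Function.comp_apply]
    rw [hGg z, hFf (g z)]

theorem IsHolomorphicSelfMap.continuous {n : ℕ} {D : Set (EuclideanSpace ℂ (Fin n))} {f : D → D}
    (hf : IsHolomorphicSelfMap D f) : Continuous f := by
  obtain ⟨F, hF, hFf⟩ := hf
  rw [continuous_induced_rng]
  have h : (Subtype.val ∘ f) = D.domRestrict F := by
    funext z
    exact (hFf z).symm
  rw [h]
  exact hF.continuousOn.domRestrict

/-- The group of biholomorphic self-maps of `D`, inside the group of all bijections of `D`
(multiplication is composition). -/
def biholomorphicSubgroup {n : ℕ} (D : Set (EuclideanSpace ℂ (Fin n))) :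
    Subgroup (Equiv.Perm D) where
  carrier := {f | IsHolomorphicSelfMap D f ∧ IsHolomorphicSelfMap D f.symm}
  one_mem' := ⟨IsHolomorphicSelfMap.id D, IsHolomorphicSelfMap.id D⟩
  mul_mem' := fun ha hb => ⟨ha.1.comp hb.1, hb.2.comp ha.2⟩
  inv_mem' := fun ha => ⟨ha.2, ha.1⟩

/-- The automorphism group `Aut(D)` of an open set `D ⊆ ℂⁿ`. It is a type of its own because it
carries the compact-open topology. -/
def HolAut {n : ℕ} (D : Set (EuclideanSpace ℂ (Fin n))) : Type :=
  ↥(biholomorphicSubgroup D)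

namespace HolAut

noncomputable instance instGroup {n : ℕ} (D : Set (EuclideanSpace ℂ (Fin n))) : Group (HolAut D) :=
  inferInstanceAs (Group ↥(biholomorphicSubgroup D))

/-- The underlying bijection of an automorphism. -/
def toPerm {n : ℕ} {D : Set (EuclideanSpace ℂ (Fin n))} (f : HolAut D) : Equiv.Perm D :=
  f.1

/-- An automorphism of `D` as a continuous map `D → D`. -/
def toContinuousMap {n : ℕ} {D : Set (EuclideanSpace ℂ (Fin n))} (f : HolAut D) : C(D, D) :=
  ⟨f.toPerm, IsHolomorphicSelfMap.continuous f.2.1⟩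

/-- The compact-open topology on `Aut(D)`, induced from the one Mathlib puts on `C(D, D)`. -/
noncomputable instance instTopologicalSpace {n : ℕ} (D : Set (EuclideanSpace ℂ (Fin n))) :
    TopologicalSpace (HolAut D) :=
  TopologicalSpace.induced toContinuousMap inferInstance

/-- The automorphism `f` of `D` extends holomorphically beyond `closure D`: it is the restriction
of a holomorphic map from an open neighbourhood of `closure D` to `ℂⁿ`. -/
def ExtendsBeyondClosure {n : ℕ} {D : Set (EuclideanSpace ℂ (Fin n))} (f : HolAut D) : Prop :=
  ∃ U : Set (EuclideanSpace ℂ (Fin n)), IsOpen U ∧ closure D ⊆ U ∧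
    ∃ F : EuclideanSpace ℂ (Fin n) → EuclideanSpace ℂ (Fin n),
      DifferentiableOn ℂ F U ∧ ∀ z : D, F z = f.toPerm z

/-- The automorphism `F` of `U` extends the automorphism `f` of `D` (where `D ⊆ U`). -/
def IsExtensionOf {n : ℕ} {D U : Set (EuclideanSpace ℂ (Fin n))} (F : HolAut U) (f : HolAut D) :
    Prop :=
  ∃ hDU : D ⊆ U, ∀ z : D,
    (F.toPerm (Set.inclusion hDU z) : EuclideanSpace ℂ (Fin n)) = f.toPerm z

end HolAut

/-!
Let `T δ` be the `δ`-neighbourhood of `D`. A holomorphic map `F` on `T δ` bounded by `M` satisfies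
`dist (F z) (F p) ≤ 2 * M / δ * dist z p` for `p ∈ D` and `dist z p < δ`, by the Schwarz lemma, and
it is determined by its values on `D` (`eqOn_thickening_of_eqOn`). The heart of the argument
is a uniform version of the hypothesis, `HolAut.exists_forall_hasBoundedExtension`: there are `δ > 0`
and `M` such that every `f ∈ H` has a holomorphic extension `Φ f` to `T δ` bounded by `M`. The sets
of those `f ∈ H` that extend to `T (1 / (k + 1))` with bound `k` cover `H`, and they are closed
because uniformly bounded holomorphic maps have holomorphic limits along ultrafilters. So Baire's
theorem gives one of them interior in the compact group `H`, and finitely many translates of this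
interior cover `H`. Composing the extension of an element of the interior with that of one of the
finitely many translating elements gives uniform constants.

By the common Schwarz bound there are `0 < δ₂ ≤ δ₁ ≤ δ` such that all `Φ f` map `T δ₂` into `T δ₁`
and `T δ₁` into `T δ`, and by the identity theorem `Φ g ∘ Φ f = Φ (g * f)` on `T δ₁`. Then
`U = ⋃ f, Φ f (T δ₂)` lies in `T δ₁` and is invariant under every `Φ g`, with inverse `Φ g⁻¹`. It is
open, since `Φ f (T δ₂)` is a neighbourhood of each of its points by continuity of `Φ f⁻¹`, and it is
connected, since each `Φ f (T δ₂)` is connected and contains `D`.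
-/

open Metric Set Filter Topology

/-! ### Bounded holomorphic maps on neighbourhoods of a set -/

section BoundedHolomorphic

variable {E G : Type*} [NormedAddCommGroup E] [NormedSpace ℂ E]
  [NormedAddCommGroup G] [NormedSpace ℂ G]

theorem mapsTo_closedBall_two_mul {E G : Type*} [NormedAddCommGroup E] [NormedAddCommGroup G]
    {f : E → G} {p : E} {r M : ℝ} (hr : 0 < r)
    (hM : ∀ z ∈ ball p r, ‖f z‖ ≤ M) : MapsTo f (ball p r) (closedBall (f p) (2 * M)) := by
  intro z hz
  rw [mem_closedBall, dist_eq_norm]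
  linarith [norm_sub_le (f z) (f p), hM z hz, hM p (mem_ball_self hr)]

/-- Second-order Taylor estimate for a bounded holomorphic map on a ball: the Schwarz lemma for maps
vanishing to second order, applied to the map minus its linear part. -/
theorem norm_sub_sub_fderiv_le {f : E → G} {p z : E} {r M : ℝ}
    (hf : DifferentiableOn ℂ f (ball p r)) (hM : ∀ z ∈ ball p r, ‖f z‖ ≤ M)
    (hz : z ∈ ball p r) :
    ‖f z - f p - fderiv ℂ f p (z - p)‖ ≤ 4 * M * (‖z - p‖ / r) ^ 2 := by
  have hr : 0 < r := nonempty_ball.1 ⟨z, hz⟩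
  have hmaps := mapsTo_closedBall_two_mul hr hM
  have hfd : HasFDerivAt f (fderiv ℂ f p) p :=
    (hf.differentiableAt (ball_mem_nhds p hr)).hasFDerivAt
  have hL := Complex.norm_fderiv_le_div_of_mapsTo_ball hf hmaps hr
  set g : E → G := fun w => f w - fderiv ℂ f p (w - p) with hg
  have hgd : DifferentiableOn ℂ g (ball p r) :=
    hf.sub (by fun_prop : Differentiable ℂ fun w => fderiv ℂ f p (w - p)).differentiableOn
  have hgp : g p = f p := by simp [hg]
  have hgm : MapsTo g (ball p r) (closedBall (g p) (4 * M)) := by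
    intro w hw
    have h1 := hmaps hw
    rw [mem_closedBall, dist_eq_norm] at h1
    have h2 : ‖fderiv ℂ f p (w - p)‖ ≤ 2 * M := by
      have h3 : ‖w - p‖ ≤ r := by rw [← dist_eq_norm]; exact (mem_ball.1 hw).le
      calc ‖fderiv ℂ f p (w - p)‖ ≤ ‖fderiv ℂ f p‖ * ‖w - p‖ := ContinuousLinearMap.le_opNorm _ _
        _ ≤ 2 * M / r * r := by gcongr; exact (norm_nonneg _).trans hL
        _ = 2 * M := by field_simp
    rw [mem_closedBall, dist_eq_norm, hgp, hg]
    have : f w - fderiv ℂ f p (w - p) - f p = (f w - f p) - fderiv ℂ f p (w - p) := by abel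
    simp only [this]
    linarith [norm_sub_le (f w - f p) (fderiv ℂ f p (w - p))]
  have ho : (fun w => g w - g p) =o[𝓝 p] (fun w => ‖w - p‖ ^ 1) := by
    have := hfd.isLittleO
    simp only [pow_one]
    refine (this.norm_right).congr_left fun w => ?_
    rw [hgp]
    exact sub_right_comm _ _ _
  have := Complex.dist_le_mul_div_pow_of_mapsTo_ball_of_isLittleO hgd hgm ho hz
  rw [dist_eq_norm, dist_eq_norm, hgp, hg, sub_right_comm] at this
  exact this

theorem exists_tendsto_ultrafilter_of_norm_le {ι X : Type*} [NormedAddCommGroup X] [ProperSpace X]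
    (u : Ultrafilter ι) {x : ι → X} {M : ℝ} (hx : ∀ᶠ i in u, ‖x i‖ ≤ M) :
    ∃ a, ‖a‖ ≤ M ∧ Tendsto x u (𝓝 a) := by
  obtain ⟨a, ha, hxa⟩ := (isCompact_closedBall (0 : X) M).ultrafilter_le_nhds' (u.map x)
    (show ∀ᶠ i in (u : Filter ι), x i ∈ closedBall 0 M from
      hx.mono fun i hi => mem_closedBall_zero_iff.2 hi)
  exact ⟨a, by simpa using ha, hxa⟩

/-- A substitute for Montel's theorem: a uniformly bounded family of holomorphic maps has a
holomorphic pointwise limit along any ultrafilter. The derivatives also converge along the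
ultrafilter, and the Taylor estimate, whose constant is uniform in the family, passes to the limit,
so no locally uniform convergence is needed. -/
theorem exists_differentiableOn_tendsto_ultrafilter [FiniteDimensional ℂ E] [FiniteDimensional ℂ G]
    {ι : Type*} (u : Ultrafilter ι) {S : Set E} (hS : IsOpen S) {F : ι → E → G} {M : ℝ}
    (hF : ∀ᶠ i in u, DifferentiableOn ℂ (F i) S ∧ ∀ z ∈ S, ‖F i z‖ ≤ M) :
    ∃ f : E → G, DifferentiableOn ℂ f S ∧ (∀ z ∈ S, ‖f z‖ ≤ M) ∧
      ∀ z ∈ S, Tendsto (fun i => F i z) u (𝓝 (f z)) := by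
  have : ProperSpace G := FiniteDimensional.proper ℂ G
  have : ProperSpace (E →L[ℂ] G) := FiniteDimensional.proper ℂ _
  have hlim : ∀ z, ∃ a : G, z ∈ S → ‖a‖ ≤ M ∧ Tendsto (fun i => F i z) u (𝓝 a) := fun z => by
    by_cases hz : z ∈ S
    · obtain ⟨a, ha⟩ := exists_tendsto_ultrafilter_of_norm_le u (hF.mono fun i hi => hi.2 z hz)
      exact ⟨a, fun _ => ha⟩
    · exact ⟨0, fun h => absurd h hz⟩
  choose f hf using hlim
  refine ⟨f, fun p hp => ?_, fun z hz => (hf z hz).1, fun z hz => (hf z hz).2⟩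
  obtain ⟨r, hr, hrS⟩ := Metric.isOpen_iff.1 hS p hp
  obtain ⟨L, -, hL⟩ := exists_tendsto_ultrafilter_of_norm_le u
    (x := fun i => fderiv ℂ (F i) p) (M := 2 * M / r) <| hF.mono fun i hi =>
      Complex.norm_fderiv_le_div_of_mapsTo_ball (hi.1.mono hrS)
        (mapsTo_closedBall_two_mul hr fun z hz => hi.2 z (hrS hz)) hr
  have hquad : ∀ z ∈ ball p r, ‖f z - f p - L (z - p)‖ ≤ 4 * M / r ^ 2 * ‖z - p‖ ^ 2 := by
    intro z hz
    have ht : Tendsto (fun i => F i z - F i p - fderiv ℂ (F i) p (z - p)) u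
        (𝓝 (f z - f p - L (z - p))) :=
      ((hf z (hrS hz)).2.sub (hf p hp).2).sub
        (((ContinuousLinearMap.apply ℂ G (z - p)).continuous.tendsto L).comp hL)
    refine le_of_tendsto ht.norm (hF.mono fun i hi => ?_)
    refine (norm_sub_sub_fderiv_le (hi.1.mono hrS) (fun w hw => hi.2 w (hrS hw)) hz).trans_eq ?_
    ring
  refine (HasFDerivAt.differentiableAt (f' := L) (.of_isLittleO ?_)).differentiableWithinAt
  have hO : (fun z => f z - f p - L (z - p)) =O[𝓝 p] fun z => ‖z - p‖ ^ 2 := by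
    refine Asymptotics.IsBigO.of_bound (4 * M / r ^ 2) ?_
    filter_upwards [ball_mem_nhds p hr] with z hz
    simpa using hquad z hz
  refine hO.trans_isLittleO ?_
  exact Asymptotics.isLittleO_pow_sub_sub p (by norm_num)

/-- A holomorphic map that is bounded on a neighbourhood of `D` and maps `D` into `D'` sends small
neighbourhoods of `D` into small neighbourhoods of `D'`, with constants that depend only on the
bound. The summand `1` only serves to make the factor positive. -/
theorem mapsTo_thickening_of_bounded {f : E → G} {D : Set E} {D' : Set G} {r M δ ε : ℝ}
    (hr : 0 < r) (hf : DifferentiableOn ℂ f (thickening r D))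
    (hM : ∀ z ∈ thickening r D, ‖f z‖ ≤ M) (hD : MapsTo f D D') (hδr : δ ≤ r)
    (hε : (2 * M / r + 1) * δ ≤ ε) : MapsTo f (thickening δ D) (thickening ε D') := by
  intro z hz
  obtain ⟨p, hp, hzp⟩ := mem_thickening_iff.1 hz
  have hsub : ball p r ⊆ thickening r D := ball_subset_thickening hp r
  have h := Complex.dist_le_div_mul_dist_of_mapsTo_ball (hf.mono hsub)
    (mapsTo_closedBall_two_mul hr fun w hw => hM w (hsub hw)) (mem_ball.2 (hzp.trans_le hδr))
  have hM0 : 0 ≤ M := (norm_nonneg _).trans (hM p (hsub (mem_ball_self hr)))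
  refine mem_thickening_iff.2 ⟨f p, hD hp, h.trans_lt ?_⟩
  calc 2 * M / r * dist z p ≤ (2 * M / r + 1) * dist z p := by gcongr; linarith
    _ < (2 * M / r + 1) * δ := by gcongr
    _ ≤ ε := hε

/-- Identity theorem: a holomorphic map on the `δ`-neighbourhood of an open set `D` is determined by
its values on `D`. Every point of the neighbourhood is joined to some `p ∈ D` by a disc in a complex
line, so the theorem in one variable suffices, and `D` need not be connected. -/
theorem eqOn_thickening_of_eqOn [CompleteSpace G] {f g : E → G} {D : Set E} (hD : IsOpen D) {δ : ℝ}
    (hf : DifferentiableOn ℂ f (thickening δ D)) (hg : DifferentiableOn ℂ g (thickening δ D))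
    (hfg : EqOn f g D) : EqOn f g (thickening δ D) := by
  intro z hz
  obtain ⟨p, hp, hzp⟩ := mem_thickening_iff.1 hz
  have hδ : 0 < δ := dist_nonneg.trans_lt hzp
  -- the complex line through `p = l 0` and `z = l 1`
  let l : ℂ → E := fun t => p + t • (z - p)
  have hl : Differentiable ℂ l := by fun_prop
  have hl0 : l 0 = p := by simp [l]
  have hl1 : l 1 = z := by simp [l]
  have hopen : IsOpen (l ⁻¹' ball p δ) := isOpen_ball.preimage hl.continuous
  have hmaps : MapsTo l (l ⁻¹' ball p δ) (thickening δ D) :=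
    fun t ht => ball_subset_thickening hp δ ht
  have hconv : IsPreconnected (l ⁻¹' ball p δ) := by
    have h : l ⁻¹' ball p δ = (fun t : ℂ => t • (z - p)) ⁻¹' ball 0 δ := by
      ext t
      simp [l, dist_eq_norm]
    rw [h]
    exact ((convex_ball (0 : E) δ).is_linear_preimage
      (f := fun t : ℂ => t • (z - p)) ⟨fun a b => add_smul a b _, fun a b => by
        simp [mul_smul]⟩).isPreconnected
  have hF : AnalyticOnNhd ℂ (f ∘ l) (l ⁻¹' ball p δ) :=
    (hf.comp hl.differentiableOn hmaps).analyticOnNhd hopen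
  have hG : AnalyticOnNhd ℂ (g ∘ l) (l ⁻¹' ball p δ) :=
    (hg.comp hl.differentiableOn hmaps).analyticOnNhd hopen
  have hev : f ∘ l =ᶠ[𝓝 0] g ∘ l := by
    have : l ⁻¹' D ∈ 𝓝 (0 : ℂ) :=
      hl.continuous.continuousAt.preimage_mem_nhds (by rw [hl0]; exact hD.mem_nhds hp)
    filter_upwards [this] with t ht using hfg ht
  have := hF.eqOn_of_preconnected_of_eventuallyEq hG hconv (z₀ := 0) (by simp [hl0, hδ]) hev
    (x := 1) (by simpa [hl1] using hzp)
  simpa [hl1] using this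

end BoundedHolomorphic

theorem IsPreconnected.thickening {E : Type*} [SeminormedAddCommGroup E] [NormedSpace ℝ E]
    {D : Set E} (hD : IsPreconnected D) (δ : ℝ) : IsPreconnected (thickening δ D) := by
  rcases D.eq_empty_or_nonempty with rfl | ⟨x, hx⟩
  · simpa using isPreconnected_empty
  refine isPreconnected_of_forall x fun z hz => ?_
  obtain ⟨p, hp, hzp⟩ := mem_thickening_iff.1 hz
  have hδ : 0 < δ := dist_nonneg.trans_lt hzp
  exact ⟨D ∪ ball p δ,
    union_subset (self_subset_thickening hδ D) (ball_subset_thickening hp δ),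
    Or.inl hx, Or.inr hzp,
    hD.union p hp (mem_ball_self hδ) (convex_ball p δ).isPreconnected⟩

/-! ### Uniform extension of the elements of a compact group -/

namespace HolAut

variable {n : ℕ} {D : Set (EuclideanSpace ℂ (Fin n))}

/-- The automorphism `f` of `D` extends to a holomorphic map, bounded by `M`, on the
`δ`-neighbourhood of `D` (which is also the `δ`-neighbourhood of `closure D`). -/
def HasBoundedExtension (δ M : ℝ) (f : HolAut D) : Prop :=
  ∃ F : EuclideanSpace ℂ (Fin n) → EuclideanSpace ℂ (Fin n),
    DifferentiableOn ℂ F (thickening δ D) ∧ (∀ z ∈ thickening δ D, ‖F z‖ ≤ M) ∧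
      ∀ z : D, F z = f.toPerm z

theorem HasBoundedExtension.mono {δ δ' M M' : ℝ} {f : HolAut D} (hδ : δ' ≤ δ) (hM : M ≤ M')
    (hf : f.HasBoundedExtension δ M) : f.HasBoundedExtension δ' M' := by
  obtain ⟨F, hF, hFM, hFf⟩ := hf
  have hsub := thickening_mono hδ D
  exact ⟨F, hF.mono hsub, fun z hz => (hFM z (hsub hz)).trans hM, hFf⟩

theorem ExtendsBeyondClosure.exists_hasBoundedExtension (hD : Bornology.IsBounded D)
    {f : HolAut D} (hf : f.ExtendsBeyondClosure) :
    ∃ δ > 0, ∃ M, f.HasBoundedExtension δ M := by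
  obtain ⟨U, hU, hDU, F, hF, hFf⟩ := hf
  obtain ⟨δ, hδ, hδU⟩ := hD.isCompact_closure.exists_cthickening_subset_open hU hDU
  obtain ⟨M, hM⟩ := hD.isCompact_closure.cthickening.exists_bound_of_continuousOn
    (hF.continuousOn.mono hδU)
  have hsub : thickening δ D ⊆ cthickening δ (closure D) := by
    rw [cthickening_closure]
    exact thickening_subset_cthickening δ D
  exact ⟨δ, hδ, M, F, hF.mono (hsub.trans hδU), fun z hz => hM z (hsub hz), hFf⟩

theorem continuous_toContinuousMap : Continuous (toContinuousMap : HolAut D → C(D, D)) :=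
  continuous_induced_dom

theorem continuous_toPerm_apply (z : D) : Continuous fun f : HolAut D => f.toPerm z :=
  (continuous_eval_const (F := C(D, D)) z).comp continuous_toContinuousMap

theorem toContinuousMap_injective : Function.Injective (toContinuousMap : HolAut D → C(D, D)) :=
  fun _ _ h => Subtype.ext (Equiv.ext fun z => DFunLike.congr_fun h z)

instance : T2Space (HolAut D) :=
  .of_injective_continuous toContinuousMap_injective continuous_toContinuousMap

theorem continuous_mul_left (g : HolAut D) : Continuous fun f : HolAut D => g * f :=
  continuous_induced_rng.2
    ((ContinuousMap.continuous_postcomp g.toContinuousMap).comp continuous_toContinuousMap)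

/-- Closedness in the compact-open topology, of which only pointwise convergence on `D` is used: the
ultrafilter limit of the extensions extends the limit automorphism. -/
theorem isClosed_setOf_hasBoundedExtension {δ : ℝ} (hδ : 0 < δ) (M : ℝ) :
    IsClosed {f : HolAut D | f.HasBoundedExtension δ M} := by
  refine isClosed_iff_ultrafilter.2 fun f u hu hmem => ?_
  have hex : ∀ g : HolAut D, ∃ F : EuclideanSpace ℂ (Fin n) → EuclideanSpace ℂ (Fin n),
      g.HasBoundedExtension δ M → DifferentiableOn ℂ F (thickening δ D) ∧
        (∀ z ∈ thickening δ D, ‖F z‖ ≤ M) ∧ ∀ z : D, F z = g.toPerm z := fun g => by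
    by_cases hg : g.HasBoundedExtension δ M
    · exact hg.imp fun F hF _ => hF
    · exact ⟨0, fun h => absurd h hg⟩
  choose F hF using hex
  have hev : ∀ᶠ g in (u : Filter (HolAut D)), g.HasBoundedExtension δ M := hmem
  obtain ⟨G, hG, hGM, hlim⟩ := exists_differentiableOn_tendsto_ultrafilter u
    isOpen_thickening (F := F) (hev.mono fun g hg => ⟨(hF g hg).1, (hF g hg).2.1⟩)
  refine ⟨G, hG, hGM, fun z => ?_⟩
  refine tendsto_nhds_unique (hlim z (self_subset_thickening hδ D z.2)) ?_
  have hval : Tendsto (fun g : HolAut D => (g.toPerm z : EuclideanSpace ℂ (Fin n))) u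
      (𝓝 (f.toPerm z)) :=
    ((continuous_subtype_val.comp (continuous_toPerm_apply z)).tendsto f).mono_left hu
  exact hval.congr' (hev.mono fun g hg => ((hF g hg).2.2 z).symm)

/-- If `v` extends to the `r`-neighbourhood of `D` with bound `M`, then the size of the
neighbourhood to which `g * v` extends depends only on `r`, `M` and the size for `g`. -/
theorem HasBoundedExtension.mul {g v : HolAut D} {δ ε r M N : ℝ} (hr : 0 < r) (hδ : δ ≤ r)
    (hε : (2 * M / r + 1) * δ ≤ ε) (hg : g.HasBoundedExtension ε N)
    (hv : v.HasBoundedExtension r M) : (g * v).HasBoundedExtension δ N := by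
  obtain ⟨F, hF, hFM, hFv⟩ := hv
  obtain ⟨G, hG, hGN, hGg⟩ := hg
  have hmaps : MapsTo F (thickening δ D) (thickening ε D) :=
    mapsTo_thickening_of_bounded hr hF hFM
      (fun z hz => by rw [hFv ⟨z, hz⟩]; exact (v.toPerm ⟨z, hz⟩).2) hδ hε
  refine ⟨G ∘ F, hG.comp (hF.mono (thickening_mono hδ D)) hmaps,
    fun z hz => hGN _ (hmaps hz), fun z => ?_⟩
  rw [Function.comp_apply, hFv z, hGg]
  rfl

/-- All elements of `H` extend to one common neighbourhood of `closure D`, with a common bound. By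
Baire's theorem this holds on a nonempty open part of `H`, and finitely many left translates of that
part cover `H`. -/
theorem exists_forall_hasBoundedExtension (hD : Bornology.IsBounded D) {H : Subgroup (HolAut D)}
    (hH : IsCompact (H : Set (HolAut D))) (hext : ∀ f ∈ H, f.ExtendsBeyondClosure) :
    ∃ δ > 0, ∃ M ≥ 0, ∀ f ∈ H, f.HasBoundedExtension δ M := by
  have : CompactSpace H := isCompact_iff_compactSpace.1 hH
  let A : ℕ → Set H := fun k => {f | (f : HolAut D).HasBoundedExtension (1 / (k + 1)) k}
  have hA : ∀ k, IsClosed (A k) := fun k =>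
    (isClosed_setOf_hasBoundedExtension (by positivity) _).preimage continuous_subtype_val
  have hA_univ : ⋃ k, A k = univ := by
    refine eq_univ_of_forall fun f => mem_iUnion.2 ?_
    obtain ⟨δ, hδ, M, hM⟩ := (hext f f.2).exists_hasBoundedExtension hD
    obtain ⟨k, hk⟩ := exists_nat_one_div_lt hδ
    obtain ⟨m, hm⟩ := exists_nat_ge M
    refine ⟨max k m, hM.mono (le_trans ?_ hk.le) (hm.trans ?_)⟩
    · gcongr
      exact_mod_cast le_max_left k m
    · exact_mod_cast le_max_right k m
  -- `H` is a Baire space, being compact and Hausdorff.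
  obtain ⟨k, v, hv⟩ := nonempty_interior_of_iUnion_of_closed hA hA_univ
  have hcont : ∀ g : H, Continuous fun f : H => g⁻¹ * f := fun g =>
    ((continuous_mul_left _).comp continuous_subtype_val).subtype_mk _
  obtain ⟨t, ht⟩ := isCompact_univ.elim_finite_subcover
    (fun g : H => (fun f => g⁻¹ * f) ⁻¹' interior (A k))
    (fun g => isOpen_interior.preimage (hcont g))
    (fun f _ => mem_iUnion.2 ⟨f * v⁻¹, by simpa using hv⟩)
  have hr : (0 : ℝ) < 1 / (k + 1) := by positivity
  have hfin : ∃ ε > 0, ∃ N : ℝ, 0 ≤ N ∧ ∀ g ∈ t, (g : HolAut D).HasBoundedExtension ε N := by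
    clear ht
    induction t using Finset.cons_induction with
    | empty => exact ⟨1, one_pos, 0, le_rfl, by simp⟩
    | cons g t _ ih =>
      obtain ⟨ε, hε, N, hN, h⟩ := ih
      obtain ⟨δ, hδ, M, hM⟩ := (hext g g.2).exists_hasBoundedExtension hD
      refine ⟨min δ ε, lt_min hδ hε, max M N, hN.trans (le_max_right _ _), fun f hf => ?_⟩
      rcases Finset.mem_cons.1 hf with rfl | hf
      · exact hM.mono (min_le_left _ _) (le_max_left _ _)
      · exact (h f hf).mono (min_le_right _ _) (le_max_right _ _)
  obtain ⟨ε, hε, N, hN, hfin⟩ := hfin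
  -- the constant of `mapsTo_thickening_of_bounded` for the elements of `A k`
  set C : ℝ := 2 * k / (1 / (k + 1)) + 1 with hC
  have hC0 : 0 < C := by positivity
  refine ⟨min (1 / (k + 1)) (ε / C), lt_min hr (div_pos hε hC0), N, hN, fun f hf => ?_⟩
  obtain ⟨g, hg, hgf⟩ := mem_iUnion₂.1 (ht (mem_univ (⟨f, hf⟩ : H)))
  have hw := interior_subset hgf
  have hmul := (hfin g hg).mul hr (min_le_left _ (ε / C))
    ((mul_le_mul_of_nonneg_left (min_le_right _ _) hC0.le).trans_eq (mul_div_cancel₀ ε hC0.ne')) hw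
  simpa using hmul

/-! ### The invariant domain -/

/-- A holomorphic self-map of `U` that has a holomorphic inverse on `U` and agrees with `f` on `D` is
an automorphism of `U` extending `f`. -/
theorem exists_isExtensionOf {U : Set (EuclideanSpace ℂ (Fin n))} {f : HolAut D} (hDU : D ⊆ U)
    {F G : EuclideanSpace ℂ (Fin n) → EuclideanSpace ℂ (Fin n)}
    (hF : DifferentiableOn ℂ F U) (hG : DifferentiableOn ℂ G U) (hFU : MapsTo F U U)
    (hGU : MapsTo G U U) (hGF : LeftInvOn G F U) (hFG : RightInvOn G F U)
    (hFf : ∀ z : D, F z = f.toPerm z) : ∃ A : HolAut U, A.IsExtensionOf f :=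
  let e : Equiv.Perm U :=
    { toFun := hFU.restrict F U U
      invFun := hGU.restrict G U U
      left_inv := fun z => Subtype.ext (hGF z.2)
      right_inv := fun z => Subtype.ext (hFG z.2) }
  ⟨⟨e, ⟨F, hF, fun _ => rfl⟩, ⟨G, hG, fun _ => rfl⟩⟩, hDU, hFf⟩

end HolAut

open HolAut in
theorem theorem2p1 (n : ℕ) (D : Set (EuclideanSpace ℂ (Fin n)))
    (hD_open : IsOpen D) (hD_conn : IsConnected D) (hD_bdd : Bornology.IsBounded D)
    (H : Subgroup (HolAut D)) (hH : IsCompact (H : Set (HolAut D)))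
    (hext : ∀ f ∈ H, f.ExtendsBeyondClosure) :
    ∃ U : Set (EuclideanSpace ℂ (Fin n)), IsOpen U ∧ IsConnected U ∧ closure D ⊆ U ∧
      ∀ f ∈ H, ∃ F : HolAut U, F.IsExtensionOf f := by
  obtain ⟨δ₀, hδ₀, M, hM, hbdd⟩ := exists_forall_hasBoundedExtension hD_bdd hH hext
  choose Φ hΦ hΦM hΦf using fun f : H => hbdd f f.2
  set C : ℝ := 2 * M / δ₀ + 1 with hC
  have hC1 : 1 ≤ C := by rw [hC]; linarith [show 0 ≤ 2 * M / δ₀ by positivity]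
  have hC0 : 0 < C := by linarith
  -- Every `Φ f` maps the `δ₂`-neighbourhood of `D` into the `δ₁`-neighbourhood, and that one into
  -- the `δ₀`-neighbourhood, on which all `Φ f` are defined.
  obtain ⟨δ₁, hδ₁, h10, hC10⟩ : ∃ δ₁ > 0, δ₁ ≤ δ₀ ∧ C * δ₁ ≤ δ₀ :=
    ⟨δ₀ / C, by positivity, div_le_self hδ₀.le hC1, (mul_div_cancel₀ δ₀ hC0.ne').le⟩
  obtain ⟨δ₂, hδ₂, h21, hC21⟩ : ∃ δ₂ > 0, δ₂ ≤ δ₁ ∧ C * δ₂ ≤ δ₁ :=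
    ⟨δ₁ / C, by positivity, div_le_self hδ₁.le hC1, (mul_div_cancel₀ δ₁ hC0.ne').le⟩
  have hΦD : ∀ f, MapsTo (Φ f) D D := fun f z hz => by
    rw [hΦf f ⟨z, hz⟩]
    exact (toPerm f.1 ⟨z, hz⟩).2
  have hmaps₁ : ∀ f, MapsTo (Φ f) (thickening δ₁ D) (thickening δ₀ D) := fun f =>
    mapsTo_thickening_of_bounded hδ₀ (hΦ f) (hΦM f) (hΦD f) h10 hC10
  have hmaps₂ : ∀ f, MapsTo (Φ f) (thickening δ₂ D) (thickening δ₁ D) := fun f =>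
    mapsTo_thickening_of_bounded hδ₀ (hΦ f) (hΦM f) (hΦD f) (h21.trans h10) hC21
  have hΦ₁ : ∀ f, DifferentiableOn ℂ (Φ f) (thickening δ₁ D) := fun f =>
    (hΦ f).mono (thickening_mono h10 D)
  have hcomp : ∀ g f, EqOn (Φ g ∘ Φ f) (Φ (g * f)) (thickening δ₁ D) := fun g f =>
    eqOn_thickening_of_eqOn hD_open ((hΦ g).comp (hΦ₁ f) (hmaps₁ f)) (hΦ₁ _) fun z hz => by
      rw [Function.comp_apply, hΦf f ⟨z, hz⟩, hΦf, hΦf (g * f) ⟨z, hz⟩]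
      rfl
  have hone : EqOn (Φ 1) id (thickening δ₁ D) :=
    eqOn_thickening_of_eqOn hD_open (hΦ₁ 1) differentiableOn_id fun z hz => hΦf 1 ⟨z, hz⟩
  have hinv : ∀ g, LeftInvOn (Φ g⁻¹) (Φ g) (thickening δ₁ D) := fun g z hz => by
    have h := hcomp g⁻¹ g hz
    rw [inv_mul_cancel, hone hz] at h
    exact h
  have hinv' : ∀ g, RightInvOn (Φ g⁻¹) (Φ g) (thickening δ₁ D) := fun g => by
    simpa using hinv g⁻¹
  set U : Set (EuclideanSpace ℂ (Fin n)) := ⋃ f, Φ f '' thickening δ₂ D with hU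
  have hU₁ : U ⊆ thickening δ₁ D := iUnion_subset fun f => (hmaps₂ f).image_subset
  have hmapsU : ∀ g, MapsTo (Φ g) U U := by
    intro g w hw
    obtain ⟨f, z, hz, rfl⟩ := mem_iUnion.1 hw
    exact mem_iUnion.2 ⟨g * f, z, hz, (hcomp g f (thickening_mono h21 D hz)).symm⟩
  have hsub : thickening δ₂ D ⊆ U := fun z hz =>
    mem_iUnion.2 ⟨1, z, hz, hone (thickening_mono h21 D hz)⟩
  have hDU : D ⊆ U := (self_subset_thickening hδ₂ D).trans hsub
  refine ⟨U, ?_, ?_, (closure_subset_thickening hδ₂ D).trans hsub, fun f hf => ?_⟩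
  -- `U` is open because near a point of `Φ f '' thickening δ₂ D` the map `Φ f⁻¹` is a continuous
  -- inverse of `Φ f`.
  · refine isOpen_iff_mem_nhds.2 fun w hw => ?_
    obtain ⟨f, z, hz, rfl⟩ := mem_iUnion.1 hw
    have h₁ := isOpen_thickening.mem_nhds (hU₁ hw)
    have hcont : ContinuousAt (Φ f⁻¹) (Φ f z) := (hΦ₁ f⁻¹).continuousOn.continuousAt h₁
    have h₂ : Φ f⁻¹ ⁻¹' thickening δ₂ D ∈ 𝓝 (Φ f z) :=
      hcont.preimage_mem_nhds (isOpen_thickening.mem_nhds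
        (by rwa [hinv f (thickening_mono h21 D hz)]))
    filter_upwards [h₁, h₂] with w hw₁ hw₂
    exact mem_iUnion.2 ⟨f, _, hw₂, hinv' f hw₁⟩
  · obtain ⟨x, hx⟩ := hD_conn.nonempty
    refine ⟨⟨x, hDU hx⟩, isPreconnected_iUnion ⟨x, mem_iInter.2 fun f => ?_⟩ fun f => ?_⟩
    · exact ⟨Φ f⁻¹ x, self_subset_thickening hδ₂ D (hΦD _ hx),
        hinv' f (self_subset_thickening hδ₁ D hx)⟩
    · exact (hD_conn.isPreconnected.thickening δ₂).image _
        ((hΦ₁ f).continuousOn.mono (thickening_mono h21 D))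
  · exact exists_isExtensionOf hDU ((hΦ₁ ⟨f, hf⟩).mono hU₁) ((hΦ₁ _).mono hU₁) (hmapsU _)
      (hmapsU _) ((hinv _).mono hU₁) ((hinv' _).mono hU₁) (hΦf ⟨f, hf⟩)
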